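/- Let $n\ge 1$, $\mathcal N=\{1,\dots,n\}$, let $\Delta=\{p\in[0,1]^n:\sum_i p_i=1\}$ be the set of probability vectors on $\mathcal N$, $\operatorname{int}\Delta=\{p\in\Delta: 0<p_i<1\text{ for all }i\}$, $\mathcal T=\{v\in\mathbb R^n:\sum_i v_i=0\}$, let $S^{n-1}$ be the Euclidean unit sphere of $\mathbb R^n$, and let $\Pi_{n-1}:\mathbb R^n\to\mathbb R^{n-1}$ be the projection onto the first $n-1$ coordinates. Let $S:\Delta\times\mathcal N\to[-\infty,\infty]$ be a strictly proper scoring rule: writing $S(p,q)=\sum_i q_i\,S(p,i)$ (with $0\cdot(\pm\infty)=0$) for the expected score of the report $p$ under $q$, we have $S(q,q)>S(p,q)$ for all $p\ne q$ in $\Delta$. Assume that $S$ is twice differentiable, i.e. for each $i$ the function $p\mapsto S(p,i)$ is finite and twice differentiable on $\operatorname{int}\Delta$ (regarded as a relatively open subset of the hyperplane $\sum_i p_i=1$). Let $\{F(p)\}_{p\in\operatorname{int}\Delta}$ be a random field on a probability space with values in $\Delta$, and for $p\in\operatorname{int}\Delta$ and $v\in\mathcal T\cap S^{n-1}$ let $$Y(p,v)=\bigl(\Pi_{n-1}F(p),\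 \Pi_{n-1}\,\partial_vF(p)\bigr)\in\mathbb R^{n-1}\times\mathbb R^{n-1}.$$ Assume that - the sample paths $p\mapsto F(p)$ are twice continuously differentiable on $\operatorname{int}\Delta$; - there is a constant $C$ such that for every $p\in\operatorname{int}\Delta$ and every $v\in\mathcal T\cap S^{n-1}$ the random vector $Y(p,v)$ has a joint density $h_{Y(p,v)}$ (with respect to Lebesgue measure) with $h_{Y(p,v)}\le C$. Then, almost surely, there is no point $p\in\operatorname{int}\Delta$ such that both $F(p)=p$ and $p\in\operatorname{argmax}_{p'\in\operatorname{int}\Delta}S(p',F(p'))$. -/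

import Mathlib

open MeasureTheory Topology
open scoped NNReal ENNReal

/-- A scoring rule for `n` outcomes: `S p i` is the extended-real score of the prediction `p` when
outcome `i` occurs. Only its values at `p ∈ stdSimplex ℝ (Fin n)` are ever used. -/
abbrev ScoringRule (n : ℕ) := (Fin n → ℝ) → Fin n → EReal

/-- The expected score `S(p, q) = 𝔼_{i ∼ q} S(p, i)`, with the convention `0 · (±∞) = 0`. -/
noncomputable def expectedScore {n : ℕ} (S : ScoringRule n) (p q : Fin n → ℝ) : EReal :=
  ∑ i, (q i : EReal) * S p i

/-- Strict propriety: honest reporting is the unique maximizer of the expected score. -/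
def IsStrictlyProper {n : ℕ} (S : ScoringRule n) : Prop :=
  ∀ p ∈ stdSimplex ℝ (Fin n), ∀ q ∈ stdSimplex ℝ (Fin n), p ≠ q →
    expectedScore S p q < expectedScore S q q

/-- The open simplex `{p ∈ Δ | ∀ i, 0 < p i < 1}`. -/
def simplexInterior (n : ℕ) : Set (Fin n → ℝ) :=
  {p | p ∈ stdSimplex ℝ (Fin n) ∧ ∀ i, 0 < p i ∧ p i < 1}

/-- The tangent space `{v ∈ ℝⁿ | ∑ i, v i = 0}` of the simplex. -/
def simplexTangent (n : ℕ) : Submodule ℝ (Fin n → ℝ) where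
  carrier := {v | ∑ i, v i = 0}
  add_mem' := by
    intro a b ha hb
    simp only [Set.mem_ofPred_eq, Pi.add_apply, Finset.sum_add_distrib] at *
    rw [ha, hb, add_zero]
  zero_mem' := by simp
  smul_mem' := by
    intro c x hx
    simp only [Set.mem_ofPred_eq, Pi.smul_apply, smul_eq_mul, ← Finset.mul_sum] at *
    rw [hx, mul_zero]

/-- `φ` is twice (Fréchet) differentiable at `x`: it is differentiable in a neighbourhood of `x`
and its derivative is differentiable at `x`. -/
def TwiceDifferentiableAt {E G : Type*} [NormedAddCommGroup E] [NormedSpace ℝ E]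
    [NormedAddCommGroup G] [NormedSpace ℝ G] (φ : E → G) (x : E) : Prop :=
  (∀ᶠ y in 𝓝 x, DifferentiableAt ℝ φ y) ∧ DifferentiableAt ℝ (fderiv ℝ φ) x

/-- A scoring rule is twice differentiable if, for every outcome `i`, the function `p ↦ S p i` is
finite and twice differentiable on the open simplex, where differentiability is understood along
the simplex, i.e. for displacements `u` in the tangent space. -/
def ScoringRule.IsTwiceDifferentiable {n : ℕ} (S : ScoringRule n) : Prop :=
  ∀ i, ∀ p ∈ simplexInterior n, S p i ≠ ⊥ ∧ S p i ≠ ⊤ ∧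
    TwiceDifferentiableAt (fun u : simplexTangent n => (S (p + (u : Fin n → ℝ)) i).toReal) 0

/-- `f` is twice continuously differentiable on the open simplex (along the simplex). -/
def IsC2OnSimplex {n : ℕ} (f : (Fin n → ℝ) → (Fin n → ℝ)) : Prop :=
  ∀ p ∈ simplexInterior n, ContDiffAt ℝ 2 (fun u : simplexTangent n => f (p + (u : Fin n → ℝ))) 0

/-- The projection `ℝⁿ → ℝⁿ⁻¹` onto the first `n - 1` coordinates. -/
def dropLast {n : ℕ} (x : Fin n → ℝ) : Fin (n - 1) → ℝ :=
  fun i => x (i.castLE (Nat.sub_le n 1))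

/-- The random vector `Y(p, v) = (Π F(p), Π ∂ᵥF(p))`, with `Π` the projection `dropLast`. -/
noncomputable def valueAndDeriv {Ω : Type*} {n : ℕ} (F : (Fin n → ℝ) → Ω → (Fin n → ℝ))
    (p v : Fin n → ℝ) (ω : Ω) : (Fin (n - 1) → ℝ) × (Fin (n - 1) → ℝ) :=
  (dropLast (F p ω), dropLast (lineDeriv ℝ (fun x => F x ω) p v))

/-- The random vector `Y` has a density (with respect to Lebesgue measure) bounded by `C`. -/
def HasDensityBoundedBy {Ω E : Type*} [MeasurableSpace Ω] [MeasureSpace E] (μ : Measure Ω)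
    (Y : Ω → E) (C : ℝ≥0) : Prop :=
  AEMeasurable Y μ ∧ ∃ h : E → ℝ≥0∞, Measurable h ∧ (∀ y, h y ≤ C) ∧
    μ.map Y = (volume : Measure E).withDensity h

/-- `p` is a performatively optimal report among the reports in `A`, for the belief function `f`:
`p ∈ argmax_{p' ∈ A} S(p', f(p'))`. -/
def IsPerformativelyOptimalOn {n : ℕ} (S : ScoringRule n) (f : (Fin n → ℝ) → (Fin n → ℝ))
    (A : Set (Fin n → ℝ)) (p : Fin n → ℝ) : Prop :=
  p ∈ A ∧ ∀ p' ∈ A, expectedScore S p' (f p') ≤ expectedScore S p (f p)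

/-!
The argument counts equations. Let `p = F p` be an interior fixed point which maximizes
`p' ↦ S(p', F p')`, and fix a tangent direction `v`. Propriety says that `p` also maximizes
`p' ↦ S(p', p)`, so the derivative of the score in the report vanishes at `p`, and the first-order
condition reduces to `∑ i, S(p, i) ∂ᵥFᵢ(p) = 0`
(`sum_scoreDifference_mul_lineDeriv_eq_zero`). As the components of `∂ᵥF` sum to zero, this is a
linear equation on the first `d = n - 1` of them, with coefficients the score differences
`b(p) = (S(p, i) - S(p, n))ᵢ`.

By strict propriety, `b` vanishes at one point at most (`eq_of_score_constant`), and a given point is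
a fixed point with probability zero because `F` has a density there. Away from this point, `p` solves
the `d + 1` equations `F p = p`, `⟨b p, ∂ᵥF p⟩ = 0` in `d` unknowns
(`measure_exists_degenerate_zero`). Both sides are differentiable in `p`, so at all points within
`1 / N` of a solution the equations hold up to `O(1 / N)`. The bounded joint density of
`(F, ∂ᵥF)` gives this probability `O(N ^ (-(d + 1)))` at each single point
(`measure_near_degenerate_le`), and a grid of `(N + 1) ^ d` points detects every solution, so the
probability of a solution is `O(1 / N)` for every `N` (`measure_exists_grid_eq_zero`). The constants
depend on the sample path and on the solution; countably many bounds on them suffice. Only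
differentiability at the solution is used, which is all that is available for `b`.
-/

/-! ### Almost sure absence of zeros of overdetermined random fields -/

/-- If each event `B x N` has probability `O(N ^ (-(d + 1)))`, where `d` is the dimension, then almost
surely no `p` in the unit cube has `B x N` occurring at all points `x` within `1 / N` of `p` for all
large `N`: a grid of `(N + 1) ^ d` points meets every such neighbourhood. The set in question need
not be measurable; it is null for the outer measure. -/
theorem measure_exists_grid_eq_zero {Ω ι : Type*} [MeasurableSpace Ω] [Fintype ι]
    (μ : Measure Ω) (B : (ι → ℝ) → ℕ → Set Ω) (K : ℝ≥0)
    (hB : ∀ x, ∀ N : ℕ, 0 < N → μ (B x N) ≤ K * (ENNReal.ofReal (1 / N)) ^ (Fintype.card ι + 1)) :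
    μ {ω | ∃ p ∈ Set.Icc (0 : ι → ℝ) 1, ∀ᶠ N : ℕ in Filter.atTop,
      ∀ x, dist x p ≤ 1 / N → ω ∈ B x N} = 0 := by
  classical
  set d := Fintype.card ι
  let grid : (N : ℕ) → (ι → Fin (N + 1)) → ι → ℝ := fun N k i => (k i : ℝ) / N
  let U : ℕ → Set Ω := fun N => ⋃ k, B (grid N k) N
  have hU : ∀ N : ℕ, 0 < N → μ (U N) ≤ ENNReal.ofReal (K * 2 ^ d * (1 / N)) := by
    intro N hN
    have hN' : (0 : ℝ) < N := by exact_mod_cast hN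
    have hN1 : (1 : ℝ) ≤ N := by exact_mod_cast hN
    calc μ (U N) ≤ ∑ k : ι → Fin (N + 1), μ (B (grid N k) N) := measure_iUnion_fintype_le _ _
      _ ≤ ∑ _k : ι → Fin (N + 1), K * (ENNReal.ofReal (1 / N)) ^ (d + 1) :=
        Finset.sum_le_sum fun k _ => hB _ N hN
      _ = ENNReal.ofReal (((N : ℝ) + 1) ^ d * (K * (1 / N) ^ (d + 1))) := by
        rw [Finset.sum_const, Finset.card_univ, Fintype.card_fun, Fintype.card_fin, nsmul_eq_mul,
          ENNReal.ofReal_mul (by positivity), ENNReal.ofReal_mul (by positivity),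
          ← ENNReal.ofReal_pow (by positivity), ENNReal.ofReal_coe_nnreal,
          show ((N : ℝ) + 1) ^ d = (((N + 1) ^ d : ℕ) : ℝ) by push_cast; rfl,
          ENNReal.ofReal_natCast]
      _ ≤ ENNReal.ofReal (K * 2 ^ d * (1 / N)) := by
        apply ENNReal.ofReal_le_ofReal
        have h1 : ((N : ℝ) + 1) * (1 / N) ≤ 2 := by
          rw [mul_one_div, div_le_iff₀ hN']
          linarith
        calc ((N : ℝ) + 1) ^ d * (K * (1 / N) ^ (d + 1))
            = K * (((N : ℝ) + 1) * (1 / N)) ^ d * (1 / N) := by rw [mul_pow]; ring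
          _ ≤ K * 2 ^ d * (1 / N) := by gcongr
  have hlim : Filter.Tendsto (fun N : ℕ => ENNReal.ofReal (K * 2 ^ d * (1 / N)))
      Filter.atTop (𝓝 0) := by
    have := (tendsto_one_div_atTop_nhds_zero_nat (𝕜 := ℝ)).const_mul (K * 2 ^ d : ℝ)
    rw [mul_zero] at this
    simpa using ENNReal.tendsto_ofReal this
  have hnull : ∀ M : ℕ, μ (⋂ N ≥ M, U N) = 0 := by
    intro M
    refine le_antisymm (ge_of_tendsto hlim ?_) zero_le
    filter_upwards [Filter.eventually_ge_atTop M, Filter.eventually_gt_atTop 0] with N hM h0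
    exact (measure_mono (Set.iInter₂_subset N hM)).trans (hU N h0)
  refine measure_mono_null ?_ (measure_iUnion_null hnull)
  rintro ω ⟨p, ⟨hp0, hp1⟩, hp⟩
  obtain ⟨M, hM⟩ := Filter.eventually_atTop.1 hp
  refine Set.mem_iUnion.2 ⟨M + 1, Set.mem_iInter₂.2 fun N hN => ?_⟩
  have hN0 : (0 : ℝ) < N := by exact_mod_cast (show 0 < N by omega)
  -- the grid point obtained by rounding down every coordinate of `p`
  have hk : ∀ i, ⌊N * p i⌋₊ < N + 1 := fun i => by
    rw [Nat.lt_succ_iff]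
    exact Nat.floor_le_of_le (mul_le_of_le_one_right hN0.le (hp1 i))
  refine Set.mem_iUnion.2 ⟨fun i => ⟨⌊N * p i⌋₊, hk i⟩, hM N (by omega) _ ?_⟩
  refine (dist_pi_le_iff (by positivity)).2 fun i => ?_
  have h1 := Nat.floor_le (mul_nonneg hN0.le (hp0 i))
  have h2 := Nat.lt_floor_add_one (N * p i)
  rw [Real.dist_eq, show grid N (fun i => ⟨⌊N * p i⌋₊, hk i⟩) i = (⌊N * p i⌋₊ : ℝ) / N from rfl,
    show (⌊N * p i⌋₊ : ℝ) / N - p i = (⌊N * p i⌋₊ - N * p i) / N by field_simp, abs_div,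
    abs_of_pos hN0]
  gcongr
  rw [abs_le]
  constructor <;> linarith

/-- The part of a cube of radius `m` lying in the slab `|⟨b, y⟩| ≤ ε` has volume `O(ε)`. The
implied constant does not depend on `b` as long as some coordinate of `b` is at least `1 / m` in
absolute value. -/
theorem volume_box_inter_slab_le {ι : Type*} [Fintype ι] [DecidableEq ι] (b : ι → ℝ) (j : ι)
    {m : ℝ} (hm : 0 < m) (hb : 1 / m ≤ |b j|) (ε : ℝ) :
    volume {y : ι → ℝ | ‖y‖ ≤ m ∧ |∑ i, b i * y i| ≤ ε} ≤
      ENNReal.ofReal m * (ENNReal.ofReal (2 * m) ^ (Fintype.card ι - 1) *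
        ENNReal.ofReal (2 * ε)) := by
  have hbj : b j ≠ 0 := by
    intro h
    rw [h, abs_zero] at hb
    exact absurd hb (not_le.2 (by positivity))
  -- the linear map replacing the `j`-th coordinate of `y` by `∑ i, b i * y i`
  let A : Matrix ι ι ℝ := (1 : Matrix ι ι ℝ).updateRow j b
  have hdet : A.det = b j := by
    have := Matrix.cramer_transpose_apply (1 : Matrix ι ι ℝ) b j
    rw [Matrix.transpose_one, Matrix.cramer_one] at this
    exact this.symm
  let f : (ι → ℝ) →ₗ[ℝ] (ι → ℝ) := Matrix.toLin' A
  have hfdet : LinearMap.det f = b j := by rw [LinearMap.det_toLin', hdet]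
  let s : ι → Set ℝ := fun i => if i = j then Set.Icc (-ε) ε else Set.Icc (-m) m
  have hsub : {y : ι → ℝ | ‖y‖ ≤ m ∧ |∑ i, b i * y i| ≤ ε} ⊆ f ⁻¹' (Set.univ.pi s) := by
    rintro y ⟨hy, hy'⟩ i -
    by_cases h : i = j
    · subst h
      have : f y i = ∑ k, b k * y k := by
        simp [f, A, Matrix.toLin'_apply, Matrix.mulVec, dotProduct]
      simpa only [s, if_true, this, Set.mem_Icc] using abs_le.1 hy'
    · have : f y i = y i := by
        simp [f, A, Matrix.toLin'_apply, Matrix.mulVec, dotProduct, Matrix.updateRow_ne h,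
          Matrix.one_apply]
      simpa only [s, if_neg h, this, Set.mem_Icc] using abs_le.1 ((norm_le_pi_norm y i).trans hy)
  refine (measure_mono hsub).trans ?_
  rw [Measure.addHaar_preimage_linearMap _ (by rwa [hfdet]), hfdet, volume_pi_pi]
  gcongr
  · rw [abs_inv]
    exact inv_le_of_inv_le₀ hm (by rwa [one_div] at hb)
  · rw [← Finset.prod_erase_mul _ _ (Finset.mem_univ j)]
    gcongr
    · rw [Finset.prod_congr rfl (g := fun _ => ENNReal.ofReal (2 * m)), Finset.prod_const,
        Finset.card_erase_of_mem (Finset.mem_univ j), Finset.card_univ]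
      intro i hi
      simp only [s, if_neg (Finset.ne_of_mem_erase hi), Real.volume_Icc]
      ring_nf
    · simp only [s, if_true, Real.volume_Icc]
      ring_nf
      exact le_rfl

theorem HasDensityBoundedBy.measure_preimage_le {Ω E : Type*} [MeasurableSpace Ω] [MeasureSpace E]
    {μ : Measure Ω} {Y : Ω → E} {C : ℝ≥0} (h : HasDensityBoundedBy μ Y C) {s : Set E}
    (hs : MeasurableSet s) : μ (Y ⁻¹' s) ≤ C * volume s := by
  obtain ⟨hY, g, -, hgC, hg⟩ := h
  rw [← Measure.map_apply_of_aemeasurable hY hs, hg, withDensity_apply _ hs]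
  calc ∫⁻ y in s, g y ≤ ∫⁻ _ in s, (C : ℝ≥0∞) := lintegral_mono fun y => hgC y
    _ = C * volume s := by simp

/-- If `(X, V)` has a bounded density, then `X` is `ε`-close to `x` and a truncated `V` is
`ε`-close to the hyperplane orthogonal to `b` with probability `O(ε ^ (d + 1))`. Truncating `V` is
necessary, since the whole slab has infinite volume. -/
theorem measure_near_degenerate_le {Ω ι : Type*} [MeasurableSpace Ω] [Fintype ι] {μ : Measure Ω}
    {Y : Ω → (ι → ℝ) × (ι → ℝ)} {C : ℝ≥0} (hY : HasDensityBoundedBy μ Y C) (x b : ι → ℝ) {m : ℝ}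
    (hm : 0 < m) (hb : ∃ j, 1 / m ≤ |b j|) {ε : ℝ} (hε : 0 ≤ ε) :
    μ {ω | dist (Y ω).1 x ≤ ε ∧ ‖(Y ω).2‖ ≤ m ∧ |∑ i, b i * (Y ω).2 i| ≤ ε} ≤
      C * (ENNReal.ofReal ((2 * ε) ^ Fintype.card ι) *
        (ENNReal.ofReal m * (ENNReal.ofReal (2 * m) ^ (Fintype.card ι - 1) *
          ENNReal.ofReal (2 * ε)))) := by
  classical
  obtain ⟨j, hj⟩ := hb
  let T : Set (ι → ℝ) := {y | ‖y‖ ≤ m ∧ |∑ i, b i * y i| ≤ ε}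
  have hball : IsClosed {y : ι → ℝ | ‖y‖ ≤ m} := isClosed_le continuous_norm continuous_const
  have hslab : IsClosed {y : ι → ℝ | |∑ i, b i * y i| ≤ ε} :=
    isClosed_le (continuous_abs.comp (continuous_finsetSum _ fun i _ =>
      continuous_const.mul (continuous_apply i))) continuous_const
  have hT : IsClosed T := hball.inter hslab
  refine (hY.measure_preimage_le
    (Metric.isClosed_closedBall.measurableSet.prod hT.measurableSet :
      MeasurableSet (Metric.closedBall x ε ×ˢ T))).trans ?_
  rw [Measure.volume_eq_prod, Measure.prod_prod, Real.volume_pi_closedBall _ hε]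
  gcongr
  exact volume_box_inter_slab_le b j hm hj ε

/-- The `d + 1` equations `X p = p` and `⟨b p, V p⟩ = 0` almost surely have no common solution
`p` (in the unit cube) at which the data are differentiable and `b p ≠ 0`, because there are only
`d` unknowns. -/
theorem measure_exists_degenerate_zero {Ω ι : Type*} [MeasurableSpace Ω] [Fintype ι]
    (μ : Measure Ω) (U : Set (ι → ℝ)) (X V : (ι → ℝ) → Ω → ι → ℝ) (b : (ι → ℝ) → ι → ℝ) (C : ℝ≥0)
    (hdens : ∀ x ∈ U, HasDensityBoundedBy μ (fun ω => (X x ω, V x ω)) C) :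
    μ {ω | ∃ p ∈ Set.Icc (0 : ι → ℝ) 1, U ∈ 𝓝 p ∧ X p ω = p ∧ b p ≠ 0 ∧
      ∑ i, b p i * V p ω i = 0 ∧ DifferentiableAt ℝ (fun x => X x ω) p ∧
      DifferentiableAt ℝ (fun x => V x ω) p ∧ DifferentiableAt ℝ b p} = 0 := by
  -- `m` bounds all the constants attached to a particular sample path and solution `p`
  let B : ℕ → (ι → ℝ) → ℕ → Set Ω := fun m x N =>
    {ω | (x ∈ U ∧ ∃ j, 1 / ((m : ℝ) + 1) ≤ |b x j|) ∧
      dist (X x ω) x ≤ (m + 1) * (1 / N) ∧ ‖V x ω‖ ≤ m + 1 ∧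
      |∑ i, b x i * V x ω i| ≤ (m + 1) * (1 / N)}
  have hnull := fun m : ℕ => measure_exists_grid_eq_zero μ (B m)
    (C * (2 * (m + 1)) ^ Fintype.card ι *
      ((m + 1) * ((2 * (m + 1)) ^ (Fintype.card ι - 1) * (2 * (m + 1))))) (by
    intro x N hN
    by_cases hx : x ∈ U ∧ ∃ j, 1 / ((m : ℝ) + 1) ≤ |b x j|
    · refine (measure_mono fun ω hω => hω.2).trans ((measure_near_degenerate_le (hdens x hx.1) x
        (b x) (by positivity : (0 : ℝ) < m + 1) hx.2 (by positivity)).trans_eq ?_)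
      have h1 : (m : ℝ≥0∞) + 1 = ENNReal.ofReal (m + 1) := by
        rw [ENNReal.ofReal_add (by positivity) zero_le_one]; simp
      have h2 : (2 : ℝ≥0∞) = ENNReal.ofReal 2 := by simp
      push_cast
      rw [h1, h2, ENNReal.ofReal_pow (by positivity), ENNReal.ofReal_mul zero_le_two,
        ENNReal.ofReal_mul zero_le_two, ENNReal.ofReal_mul (by positivity)]
      ring
    · rw [show B m x N = ∅ from Set.eq_empty_of_forall_notMem fun ω hω => hx hω.1]
      simp)
  refine measure_mono_null ?_ (measure_iUnion_null hnull)
  rintro ω ⟨p, hp, hU, hXp, hbp, hzero, hX, hV, hb⟩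
  obtain ⟨j, hj⟩ := Function.ne_iff.1 hbp
  have hj' : 0 < |b p j| := abs_pos.2 hj
  have hbound : ∀ {g : (ι → ℝ) → ι → ℝ}, DifferentiableAt ℝ g p → g p = 0 →
      ∃ c : ℝ, ∀ᶠ x in 𝓝 p, ‖g x‖ ≤ c * dist x p := by
    intro g hg hg0
    obtain ⟨c, hc⟩ := hg.isBigO_sub.bound
    exact ⟨c, hc.mono fun x hx => by simpa [hg0, dist_eq_norm] using hx⟩
  -- `X x - x` and `⟨b x, V x⟩` vanish at `p`, so differentiability makes them `O(dist x p)`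
  obtain ⟨c₁, hc₁⟩ := hbound (hX.sub differentiableAt_id) (by simp [hXp])
  have hinner : DifferentiableAt ℝ (fun x => ∑ i, b x i * V x ω i) p :=
    DifferentiableAt.fun_sum fun i _ => (differentiableAt_pi.1 hb i).mul (differentiableAt_pi.1 hV i)
  obtain ⟨c₂, hc₂⟩ := hinner.isBigO_sub.bound
  have hVb : ∀ᶠ x in 𝓝 p, ‖V x ω‖ < ‖V p ω‖ + 1 :=
    hV.continuousAt.norm.eventually (gt_mem_nhds (lt_add_one _))
  have hbb : ∀ᶠ x in 𝓝 p, |b p j| / 2 < |b x j| :=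
    (differentiableAt_pi.1 hb j).continuousAt.abs.eventually (lt_mem_nhds (half_lt_self hj'))
  obtain ⟨m, hm⟩ := exists_nat_ge (max (max c₁ c₂) (max (‖V p ω‖ + 1) (2 / |b p j|)))
  obtain ⟨⟨hm1, hm2⟩, hm3, hm4⟩ := by simpa only [max_le_iff] using hm
  obtain ⟨δ, hδ, hall⟩ := Metric.eventually_nhds_iff.1
    (Filter.Eventually.and (Filter.eventually_mem_set.2 hU) (hc₁.and (hc₂.and (hVb.and hbb))))
  refine Set.mem_iUnion.2 ⟨m, p, hp, ?_⟩
  have hN := (tendsto_one_div_atTop_nhds_zero_nat (𝕜 := ℝ)).eventually (gt_mem_nhds hδ)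
  filter_upwards [hN] with N hN x hx
  obtain ⟨hxU, h1, h2, h3, h4⟩ := hall (hx.trans_lt hN)
  refine ⟨⟨hxU, j, ?_⟩, ?_, by linarith, ?_⟩
  · refine le_trans ?_ h4.le
    rw [div_le_iff₀ (by positivity)]
    have := (div_le_iff₀ hj').1 hm4
    nlinarith
  · rw [dist_eq_norm]
    refine h1.trans ?_
    gcongr
    linarith
  · rw [hzero, sub_zero, Real.norm_eq_abs, ← dist_eq_norm] at h2
    refine h2.trans ?_
    gcongr
    linarith

/-! ### Coordinates on the simplex -/

/-- The parametrization of the hyperplane `∑ i, p i = 1` by the first `d` coordinates. -/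
def simplexLift (d : ℕ) (x : Fin d → ℝ) : Fin (d + 1) → ℝ :=
  Fin.snoc (α := fun _ => ℝ) x (1 - ∑ i, x i)

/-- The linear part of `simplexLift`: the parametrization of the tangent space `∑ i, v i = 0` by the
first `d` coordinates. -/
noncomputable def tangentLift (d : ℕ) : (Fin d → ℝ) →L[ℝ] simplexTangent (d + 1) :=
  LinearMap.toContinuousLinearMap
    { toFun := fun x => ⟨Fin.snoc (α := fun _ => ℝ) x (-∑ i, x i), by
        change ∑ i : Fin (d + 1), Fin.snoc (α := fun _ => ℝ) x (-∑ i, x i) i = 0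
        rw [Fin.sum_univ_castSucc]
        simp only [Fin.snoc_castSucc, Fin.snoc_last, add_neg_cancel]⟩
      map_add' := fun x y => Subtype.ext <| funext <| Fin.lastCases
        (by simp only [Submodule.coe_add, Pi.add_apply, Fin.snoc_last, Finset.sum_add_distrib,
          neg_add])
        (fun j => by simp only [Submodule.coe_add, Pi.add_apply, Fin.snoc_castSucc])
      map_smul' := fun c x => Subtype.ext <| funext <| Fin.lastCases
        (by simp only [Submodule.coe_smul, Pi.smul_apply, Fin.snoc_last, smul_eq_mul,
          ← Finset.mul_sum, mul_neg, RingHom.id_apply])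
        (fun j => by simp only [Submodule.coe_smul, Pi.smul_apply, Fin.snoc_castSucc,
          RingHom.id_apply]) }

theorem tangentLift_castSucc {d : ℕ} (w : Fin d → ℝ) (i : Fin d) :
    (tangentLift d w : Fin (d + 1) → ℝ) i.castSucc = w i := by
  simp [tangentLift]

theorem tangentLift_last {d : ℕ} (w : Fin d → ℝ) :
    (tangentLift d w : Fin (d + 1) → ℝ) (Fin.last d) = -∑ i, w i := by
  simp [tangentLift]

theorem simplexLift_castSucc {d : ℕ} (x : Fin d → ℝ) (i : Fin d) :
    simplexLift d x i.castSucc = x i := by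
  simp [simplexLift]

theorem simplexLift_last {d : ℕ} (x : Fin d → ℝ) :
    simplexLift d x (Fin.last d) = 1 - ∑ i, x i := by
  simp [simplexLift]

theorem simplexLift_init {d : ℕ} {p : Fin (d + 1) → ℝ} (hp : p ∈ stdSimplex ℝ (Fin (d + 1))) :
    simplexLift d (fun i => p i.castSucc) = p := by
  have h := hp.2
  rw [Fin.sum_univ_castSucc] at h
  ext i
  refine Fin.lastCases ?_ (fun j => ?_) i
  · rw [simplexLift_last]
    linarith
  · rw [simplexLift_castSucc]

theorem simplexLift_add {d : ℕ} (x w : Fin d → ℝ) :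
    simplexLift d (x + w) = simplexLift d x + (tangentLift d w : Fin (d + 1) → ℝ) := by
  ext i
  refine Fin.lastCases ?_ (fun j => ?_) i
  · simp only [Pi.add_apply, simplexLift_last, tangentLift_last, Finset.sum_add_distrib]
    ring
  · simp only [Pi.add_apply, simplexLift_castSucc, tangentLift_castSucc]

theorem isOpen_preimage_simplexInterior (d : ℕ) :
    IsOpen (simplexLift d ⁻¹' simplexInterior (d + 1)) := by
  have hcont : Continuous (simplexLift d) :=
    Continuous.finSnoc continuous_id (by fun_prop)
  have : simplexLift d ⁻¹' simplexInterior (d + 1) =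
      simplexLift d ⁻¹' Set.univ.pi fun _ => Set.Ioo 0 1 := by
    ext x
    constructor
    · exact fun h i _ => h.2 i
    · refine fun h => ⟨⟨fun i => (h i trivial).1.le, ?_⟩, fun i => h i trivial⟩
      simp [Fin.sum_univ_castSucc, simplexLift_castSucc, simplexLift_last]
  rw [this]
  exact (isOpen_set_pi Set.finite_univ fun _ _ => isOpen_Ioo).preimage hcont

/-- Turns differentiability along the simplex into differentiability in the coordinates of
`simplexLift`. -/
theorem comp_simplexLift_eq {d : ℕ} {β : Type*} (f : (Fin (d + 1) → ℝ) → β) (x : Fin d → ℝ) :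
    (fun y => f (simplexLift d y)) =
      (fun u : simplexTangent (d + 1) => f (simplexLift d x + (u : Fin (d + 1) → ℝ))) ∘
        fun y => tangentLift d (y - x) := by
  ext y
  simp only [Function.comp_apply, ← simplexLift_add, add_sub_cancel]

/-! ### Scores of interior reports and the first-order condition -/

theorem expectedScore_eq_coe {n : ℕ} {S : ScoringRule n} (hS : S.IsTwiceDifferentiable)
    {p : Fin n → ℝ} (hp : p ∈ simplexInterior n) (q : Fin n → ℝ) :
    expectedScore S p q = ((∑ i, q i * (S p i).toReal : ℝ) : EReal) := by
  have hsum : ∀ t : Finset (Fin n), ∑ i ∈ t, (q i : EReal) * S p i =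
      ((∑ i ∈ t, q i * (S p i).toReal : ℝ) : EReal) := by
    classical
    intro t
    induction t using Finset.induction_on with
    | empty => simp
    | insert i t hi ih =>
      rw [Finset.sum_insert hi, Finset.sum_insert hi, ih, EReal.coe_add, EReal.coe_mul,
        EReal.coe_toReal (hS i p hp).2.1 (hS i p hp).1]
  exact hsum _

/-- At most one interior report is scored the same in every outcome. If `p` and `q` were two of
them, propriety would make each of the two constants larger than the other. -/
theorem eq_of_score_constant {n : ℕ} {S : ScoringRule n} (hS : IsStrictlyProper S)
    (hS2 : S.IsTwiceDifferentiable) {p q : Fin n → ℝ} (hp : p ∈ simplexInterior n)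
    (hq : q ∈ simplexInterior n) {a c : ℝ} (hpa : ∀ i, (S p i).toReal = a)
    (hqc : ∀ i, (S q i).toReal = c) : p = q := by
  by_contra hne
  have h₁ := hS p hp.1 q hq.1 hne
  have h₂ := hS q hq.1 p hp.1 (Ne.symm hne)
  simp only [expectedScore_eq_coe hS2 hp, expectedScore_eq_coe hS2 hq, EReal.coe_lt_coe_iff, hpa,
    hqc, ← Finset.sum_mul, hp.1.2, hq.1.2, one_mul] at h₁ h₂
  exact h₁.not_gt h₂

/-- The gradient of `q ↦ S(p, q)` at `p = simplexLift d x`, in the coordinates of `simplexLift`: the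
score differences to the last outcome. -/
noncomputable def scoreDifference {d : ℕ} (S : ScoringRule (d + 1)) (x : Fin d → ℝ) : Fin d → ℝ :=
  fun i => (S (simplexLift d x) i.castSucc).toReal - (S (simplexLift d x) (Fin.last d)).toReal

theorem differentiableAt_score {d : ℕ} {S : ScoringRule (d + 1)} (hS : S.IsTwiceDifferentiable)
    {x : Fin d → ℝ} (hx : simplexLift d x ∈ simplexInterior (d + 1)) :
    DifferentiableAt ℝ (fun y i => (S (simplexLift d y) i).toReal) x := by
  refine differentiableAt_pi.2 fun i => ?_
  rw [comp_simplexLift_eq (fun p => (S p i).toReal) x]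
  refine DifferentiableAt.comp x ?_ (by fun_prop)
  simpa using (hS i _ hx).2.2.1.self_of_nhds

theorem IsC2OnSimplex.contDiffAt_comp_simplexLift {d : ℕ}
    {f : (Fin (d + 1) → ℝ) → Fin (d + 1) → ℝ} (hf : IsC2OnSimplex f) {x : Fin d → ℝ}
    (hx : simplexLift d x ∈ simplexInterior (d + 1)) :
    ContDiffAt ℝ 2 (fun y => f (simplexLift d y)) x := by
  rw [comp_simplexLift_eq f x]
  refine ContDiffAt.comp x ?_ (by fun_prop)
  simpa using hf _ hx

theorem lineDeriv_simplexLift {d : ℕ} {f : (Fin (d + 1) → ℝ) → Fin (d + 1) → ℝ} {x : Fin d → ℝ}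
    (hf : DifferentiableAt ℝ (fun y => f (simplexLift d y)) x) (w : Fin d → ℝ) :
    lineDeriv ℝ f (simplexLift d x) (tangentLift d w : Fin (d + 1) → ℝ) =
      fderiv ℝ (fun y => f (simplexLift d y)) x w := by
  rw [← hf.lineDeriv_eq_fderiv]
  simp only [lineDeriv, simplexLift_add, map_smul, Submodule.coe_smul]

/-- If `x` maximizes both `y ↦ ⟨G y, s y⟩` and `y ↦ ⟨G x, s y⟩` locally, then subtracting the two
first-order conditions leaves only the derivative of `G`. -/
theorem sum_fderiv_mul_eq_zero_of_isLocalMax {E ι : Type*} [NormedAddCommGroup E] [NormedSpace ℝ E]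
    [Fintype ι] {G s : E → ι → ℝ} {x : E} (hG : DifferentiableAt ℝ G x)
    (hs : DifferentiableAt ℝ s x) (h₁ : IsLocalMax (fun y => ∑ i, G y i * s y i) x)
    (h₂ : IsLocalMax (fun y => ∑ i, G x i * s y i) x) (w : E) :
    ∑ i, fderiv ℝ G x w i * s x i = 0 := by
  have hG' := hasFDerivAt_pi'.1 hG.hasFDerivAt
  have hs' := hasFDerivAt_pi'.1 hs.hasFDerivAt
  have e₁ := h₁.hasFDerivAt_eq_zero (HasFDerivAt.fun_sum fun i _ => (hG' i).mul (hs' i))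
  have e₂ := h₂.hasFDerivAt_eq_zero (HasFDerivAt.fun_sum fun i _ => (hs' i).const_mul (G x i))
  have e := congrArg (fun L : E →L[ℝ] ℝ => L w) (e₁.trans e₂.symm)
  simp only [_root_.sum_apply, _root_.add_apply,
    _root_.smul_apply, ContinuousLinearMap.comp_apply, ContinuousLinearMap.proj_apply,
    smul_eq_mul, Finset.sum_add_distrib] at e
  simpa [mul_comm] using e

/-- At a performatively optimal interior fixed point, `∂ᵥ f` is orthogonal to the gradient of the
expected score. By propriety the report `p = f p` also maximizes the score under the fixed belief
`p`, so the derivative of the score in the report drops out of the first-order condition. -/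
theorem sum_scoreDifference_mul_lineDeriv_eq_zero {d : ℕ} {S : ScoringRule (d + 1)}
    (hS : IsStrictlyProper S) (hS2 : S.IsTwiceDifferentiable)
    {f : (Fin (d + 1) → ℝ) → Fin (d + 1) → ℝ}
    (hf_mem : ∀ p ∈ simplexInterior (d + 1), f p ∈ stdSimplex ℝ (Fin (d + 1)))
    (hf : IsC2OnSimplex f) {x : Fin d → ℝ} (hx : simplexLift d x ∈ simplexInterior (d + 1))
    (hopt : IsPerformativelyOptimalOn S f (simplexInterior (d + 1)) (simplexLift d x))
    (hfix : f (simplexLift d x) = simplexLift d x) (w : Fin d → ℝ) :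
    ∑ i, scoreDifference S x i *
      lineDeriv ℝ f (simplexLift d x) (tangentLift d w : Fin (d + 1) → ℝ) i.castSucc = 0 := by
  have hU := (isOpen_preimage_simplexInterior d).mem_nhds hx
  have hG := (hf.contDiffAt_comp_simplexLift hx).differentiableAt two_ne_zero
  rw [lineDeriv_simplexLift hG]
  have hloc : IsLocalMax (fun y => ∑ i, f (simplexLift d y) i * (S (simplexLift d y) i).toReal)
      x := by
    filter_upwards [hU] with y hy
    have := hopt.2 _ hy
    rwa [expectedScore_eq_coe hS2 hy, expectedScore_eq_coe hS2 hx, EReal.coe_le_coe_iff] at this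
  have hprop : IsLocalMax
      (fun y => ∑ i, f (simplexLift d x) i * (S (simplexLift d y) i).toReal) x := by
    filter_upwards [hU] with y hy
    rw [hfix]
    by_cases hne : simplexLift d y = simplexLift d x
    · rw [hne]
    · have := (hS _ hy.1 _ hx.1 hne).le
      rwa [expectedScore_eq_coe hS2 hy, expectedScore_eq_coe hS2 hx, EReal.coe_le_coe_iff] at this
  have hfoc := sum_fderiv_mul_eq_zero_of_isLocalMax hG (differentiableAt_score hS2 hx) hloc hprop w
  -- the values of `f` sum to `1`, so its derivatives sum to `0`
  have hsum : ∑ i, fderiv ℝ (fun y => f (simplexLift d y)) x w i = 0 := by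
    have h := HasFDerivAt.fun_sum (u := Finset.univ) fun i _ => hasFDerivAt_pi'.1 hG.hasFDerivAt i
    have hc : (fun y => ∑ i, f (simplexLift d y) i) =ᶠ[𝓝 x] fun _ => 1 := by
      filter_upwards [hU] with y hy using (hf_mem _ hy).2
    have := congrArg (fun L : (Fin d → ℝ) →L[ℝ] ℝ => L w)
      (h.unique ((hasFDerivAt_const (1 : ℝ) x).congr_of_eventuallyEq hc))
    simpa using this
  rw [Fin.sum_univ_castSucc] at hfoc hsum
  simp only [scoreDifference, sub_mul, Finset.sum_sub_distrib, ← Finset.mul_sum]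
  rw [eq_neg_of_add_eq_zero_left hsum, Finset.sum_congr rfl fun i _ => mul_comm _ _]
  linarith

/-! ### Almost sure absence of optimal fixed points -/

theorem exists_unit_tangentLift {d : ℕ} (hd : 0 < d) :
    ∃ w : Fin d → ℝ, ‖WithLp.toLp 2 (tangentLift d w : Fin (d + 1) → ℝ)‖ = 1 := by
  let w₀ : Fin d → ℝ := fun _ => 1
  have h : WithLp.toLp 2 (tangentLift d w₀ : Fin (d + 1) → ℝ) ≠ 0 := by
    intro h
    have := congrArg (fun v => v (Fin.castSucc ⟨0, hd⟩)) h
    exact one_ne_zero ((tangentLift_castSucc w₀ ⟨0, hd⟩).symm.trans this)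
  refine ⟨‖WithLp.toLp 2 (tangentLift d w₀ : Fin (d + 1) → ℝ)‖⁻¹ • w₀, ?_⟩
  rw [map_smul, Submodule.coe_smul, WithLp.toLp_smul, norm_smul, norm_inv, norm_norm,
    inv_mul_cancel₀ (norm_ne_zero_iff.2 h)]

theorem mainTheorem6 {Ω : Type*} [MeasurableSpace Ω] (μ : Measure Ω) [IsProbabilityMeasure μ]
    {n : ℕ} (S : ScoringRule n) (hS : IsStrictlyProper S) (hS2 : S.IsTwiceDifferentiable)
    (F : (Fin n → ℝ) → Ω → (Fin n → ℝ))
    (hF_meas : ∀ p ∈ simplexInterior n, Measurable (F p))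
    (hF_mem : ∀ p ∈ simplexInterior n, ∀ ω, F p ω ∈ stdSimplex ℝ (Fin n))
    (hF_C2 : ∀ ω, IsC2OnSimplex (fun p => F p ω))
    (C : ℝ≥0)
    (hF_dens : ∀ p ∈ simplexInterior n, ∀ v ∈ simplexTangent n, ‖WithLp.toLp 2 v‖ = 1 →
      HasDensityBoundedBy μ (valueAndDeriv F p v) C) :
    ∀ᵐ ω ∂μ, ¬ ∃ p ∈ simplexInterior n,
      IsPerformativelyOptimalOn S (fun p' => F p' ω) (simplexInterior n) p ∧ F p ω = p := by
  rcases Nat.lt_or_ge n 2 with hn | hn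
  · -- for `n ≤ 1` the open simplex is empty
    refine Filter.Eventually.of_forall fun ω => ?_
    rintro ⟨p, hp, -⟩
    have hsum := hp.1.2
    interval_cases n
    · simp at hsum
    · rw [Fin.sum_univ_one] at hsum
      exact (hp.2 0).2.ne hsum
  obtain ⟨d, rfl⟩ : ∃ d, n = d + 1 := ⟨n - 1, by omega⟩
  have hd : 0 < d := by omega
  have : Nonempty (Fin d) := ⟨⟨0, hd⟩⟩
  obtain ⟨w, hw⟩ := exists_unit_tangentLift hd
  let v : Fin (d + 1) → ℝ := (tangentLift d w : Fin (d + 1) → ℝ)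
  let U : Set (Fin d → ℝ) := simplexLift d ⁻¹' simplexInterior (d + 1)
  let X : (Fin d → ℝ) → Ω → Fin d → ℝ := fun x ω i => F (simplexLift d x) ω i.castSucc
  let V : (Fin d → ℝ) → Ω → Fin d → ℝ := fun x ω i =>
    lineDeriv ℝ (fun p => F p ω) (simplexLift d x) v i.castSucc
  have hdens : ∀ x ∈ U, HasDensityBoundedBy μ (fun ω => (X x ω, V x ω)) C := fun x hx =>
    hF_dens _ hx v (tangentLift d w).2 hw
  -- a given point is almost surely not a fixed point
  have hpoint : ∀ x ∈ U, μ {ω | X x ω = x} = 0 := by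
    intro x hx
    have h := (hdens x hx).measure_preimage_le
      ((measurableSet_singleton x).prod MeasurableSet.univ)
    rw [Measure.volume_eq_prod, Measure.prod_prod, measure_singleton, zero_mul, mul_zero] at h
    refine measure_mono_null (fun ω hω => ?_) (nonpos_iff_eq_zero.1 h)
    exact ⟨hω, trivial⟩
  -- at most one point is exceptional, so it is almost surely not a fixed point either
  have hexc : μ {ω | ∃ x ∈ U, scoreDifference S x = 0 ∧ X x ω = x} = 0 := by
    by_cases hx : ∃ x₀ ∈ U, scoreDifference S x₀ = 0
    · obtain ⟨x₀, hx₀, hb₀⟩ := hx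
      have hconst : ∀ {x}, scoreDifference S x = 0 → ∀ i, (S (simplexLift d x) i).toReal =
          (S (simplexLift d x) (Fin.last d)).toReal := fun {x} hb i =>
        Fin.lastCases rfl (fun j => sub_eq_zero.1 (congrFun hb j)) i
      refine measure_mono_null ?_ (hpoint x₀ hx₀)
      rintro ω ⟨x, hx, hb, hX⟩
      have heq := eq_of_score_constant hS hS2 hx hx₀ (hconst hb) (hconst hb₀)
      have : x = x₀ := by
        ext i
        rw [← simplexLift_castSucc x, heq, simplexLift_castSucc]
      exact this ▸ hX
    · refine measure_mono_null ?_ (measure_empty (μ := μ))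
      rintro ω ⟨x, hxU, hb, -⟩
      exact hx ⟨x, hxU, hb⟩
  have hgen := measure_exists_degenerate_zero μ U X V (scoreDifference S) C hdens
  refine measure_mono_null ?_ (measure_union_null hexc hgen)
  intro ω hω
  obtain ⟨p, hp, hopt, hfix⟩ := not_not.1 hω
  obtain ⟨x, rfl⟩ : ∃ x, p = simplexLift d x := ⟨_, (simplexLift_init hp.1).symm⟩
  have hX : X x ω = x := by
    ext i
    rw [← simplexLift_castSucc x i, ← hfix]
  by_cases hb : scoreDifference S x = 0
  · exact Or.inl ⟨x, hp, hb, hX⟩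
  have hUx : U ∈ 𝓝 x := (isOpen_preimage_simplexInterior d).mem_nhds hp
  have hC2 := (hF_C2 ω).contDiffAt_comp_simplexLift hp
  have hscore := differentiableAt_pi.1 (differentiableAt_score hS2 hp)
  refine Or.inr ⟨x, ⟨fun i => ?_, fun i => ?_⟩, hUx, hX, hb,
    sum_scoreDifference_mul_lineDeriv_eq_zero hS hS2 (fun p hp => hF_mem p hp ω) (hF_C2 ω) hp hopt
      hfix w, ?_, ?_, ?_⟩
  · rw [← simplexLift_castSucc x i]
    exact (hp.2 _).1.le
  · rw [← simplexLift_castSucc x i]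
    exact (hp.2 _).2.le
  · exact differentiableAt_pi.2 fun i =>
      differentiableAt_pi.1 (hC2.differentiableAt two_ne_zero) i.castSucc
  · have hder : DifferentiableAt ℝ (fun y => fderiv ℝ (fun z => F (simplexLift d z) ω) y w) x :=
      ((hC2.fderiv_right (m := 1) (by norm_num)).differentiableAt one_ne_zero).clm_apply
        (differentiableAt_const w)
    refine differentiableAt_pi.2 fun i =>
      (differentiableAt_pi.1 hder i.castSucc).congr_of_eventuallyEq ?_
    filter_upwards [hUx] with y hy
    have hy2 := (hF_C2 ω).contDiffAt_comp_simplexLift hy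
    exact congrFun (lineDeriv_simplexLift (hy2.differentiableAt two_ne_zero) w) i.castSucc
  · exact differentiableAt_pi.2 fun i => (hscore i.castSucc).sub (hscore (Fin.last d))
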